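/- Let $K$ be a field. A Lie superalgebra over $K$ is a $\mathbb{Z}_2$-graded $K$-vector space $L=L_{\bar 0}\oplus L_{\bar 1}$ with an even bilinear bracket such that, for homogeneous $x,y,z$, $[x,y]=-(-1)^{|x||y|}[y,x]$ and $[x,[y,z]]=[[x,y],z]+(-1)^{|x||y|}[y,[x,z]]$, and such that $[x,x]=0$ for $x\in L_{\bar 0}$ and $[x,[x,x]]=0$ for $x\in L_{\bar 1}$ (the last two conditions are automatic when $2$ and $3$ are invertible in $K$). Write $Z(L)=\{x\in L\mid [x,y]=0\ \forall y\in L\}$ and $Z_2(L)=\{x\in L\mid [x,y]\in Z(L)\ \forall y\in L\}$; these are graded ideals. A Lie superalgebra $L$ is called $2$-capable if there is a Lie superalgebra $H$ (of arbitrary dimension) such that $L\cong H/Z_2(H)$, where isomorphisms are even, bijective, linear and preserve brackets. Let $A(m\mid n)$ denote the abelian Lie superalgebra (zero bracket) with even part $K^m$ and odd part $K^n$. Theorem. For all integers $m,n\ge 0$ with $(m,n)\neq(0,0)$, the Lie superalgebra $A(m\mid n)$ is $2$-capable if and only if $m+n\ge 2$. -/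

import Mathlib

universe u v w

/-- A Lie superalgebra over a field `K`: a `ZMod 2`-graded vector space `L = L₀ ⊕ L₁` with an even
bilinear bracket that is super skew-symmetric and satisfies the super Jacobi identity.
The last two axioms follow from the others as soon as `2` and `3` are invertible in `K`;
they are the usual additional requirements when they are not. -/
class LieSuperalgebra (K : Type u) (L : Type v) [Field K] [AddCommGroup L] [Module K L] where
  /-- the homogeneous components: `parity 0` is the even part, `parity 1` is the odd part -/
  parity : ZMod 2 → Submodule K L
  isCompl : IsCompl (parity 0) (parity 1)
  bracket : L →ₗ[K] L →ₗ[K] L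
  bracket_mem : ∀ i j : ZMod 2, ∀ x ∈ parity i, ∀ y ∈ parity j, bracket x y ∈ parity (i + j)
  skew : ∀ i j : ZMod 2, ∀ x ∈ parity i, ∀ y ∈ parity j,
    bracket x y = -((-1 : K) ^ (i.val * j.val) • bracket y x)
  jacobi : ∀ i j k : ZMod 2, ∀ x ∈ parity i, ∀ y ∈ parity j, ∀ z ∈ parity k,
    bracket x (bracket y z) =
      bracket (bracket x y) z + (-1 : K) ^ (i.val * j.val) • bracket y (bracket x z)
  even_self : ∀ x ∈ parity 0, bracket x x = 0
  odd_self : ∀ x ∈ parity 1, bracket x (bracket x x) = 0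

namespace LieSuperalgebra

variable (K : Type u) {L : Type v} [Field K] [AddCommGroup L] [Module K L] [LieSuperalgebra K L]

/-- Graded (two-sided) ideals. -/
structure IsGradedIdeal (I : Submodule K L) : Prop where
  bracket_left : ∀ x ∈ I, ∀ y : L, bracket (K := K) x y ∈ I
  bracket_right : ∀ x : L, ∀ y ∈ I, bracket (K := K) x y ∈ I
  homogeneous : ∀ x₀ ∈ parity (K := K) (L := L) 0, ∀ x₁ ∈ parity (K := K) (L := L) 1,
    x₀ + x₁ ∈ I → x₀ ∈ I ∧ x₁ ∈ I

theorem exists_add (x : L) : ∃ x₀ ∈ parity (K := K) (L := L) 0,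
    ∃ x₁ ∈ parity (K := K) (L := L) 1, x₀ + x₁ = x := by
  have h : x ∈ parity (K := K) (L := L) 0 ⊔ parity (K := K) (L := L) 1 := by
    rw [(isCompl (K := K) (L := L)).sup_eq_top]; trivial
  exact Submodule.mem_sup.1 h

variable (L) in
/-- The upper central series: `Z₀ = 0`, `Zₙ₊₁ = {x | [x, y] ∈ Zₙ for all y}`. -/
def upperCentral : ℕ → Submodule K L
  | 0 => ⊥
  | n + 1 =>
    { carrier := {x | ∀ y : L, bracket (K := K) x y ∈ upperCentral n}
      zero_mem' := fun y => by simp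
      add_mem' := fun {a b} ha hb y => by
        rw [map_add, LinearMap.add_apply]; exact add_mem (ha y) (hb y)
      smul_mem' := fun c a ha y => by
        rw [map_smul, LinearMap.smul_apply]; exact Submodule.smul_mem _ c (ha y) }

theorem mem_upperCentral_succ {n : ℕ} {x : L} : x ∈ upperCentral K L (n + 1) ↔
    ∀ y : L, bracket (K := K) x y ∈ upperCentral K L n := Iff.rfl

/-- A homogeneous subspace that absorbs brackets on one side is a graded ideal. -/
theorem isGradedIdeal_of_left {I : Submodule K L}
    (hl : ∀ x ∈ I, ∀ y : L, bracket (K := K) x y ∈ I)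
    (hh : ∀ x₀ ∈ parity (K := K) (L := L) 0, ∀ x₁ ∈ parity (K := K) (L := L) 1,
      x₀ + x₁ ∈ I → x₀ ∈ I ∧ x₁ ∈ I) : IsGradedIdeal K I where
  bracket_left := hl
  homogeneous := hh
  bracket_right := by
    intro x y hy
    obtain ⟨x₀, hx₀, x₁, hx₁, rfl⟩ := exists_add K x
    obtain ⟨y₀, hy₀, y₁, hy₁, rfl⟩ := exists_add K y
    obtain ⟨h₀, h₁⟩ := hh _ hy₀ _ hy₁ hy
    have key : ∀ i j : ZMod 2, ∀ a ∈ parity (K := K) (L := L) i,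
        ∀ b ∈ parity (K := K) (L := L) j, b ∈ I → bracket (K := K) a b ∈ I := by
      intro i j a ha b hb hbI
      rw [skew i j a ha b hb]
      exact neg_mem (Submodule.smul_mem _ _ (hl b hbI a))
    simp only [map_add, LinearMap.add_apply]
    exact add_mem (add_mem (key 0 0 _ hx₀ _ hy₀ h₀) (key 1 0 _ hx₁ _ hy₀ h₀))
      (add_mem (key 0 1 _ hx₀ _ hy₁ h₁) (key 1 1 _ hx₁ _ hy₁ h₁))

theorem isGradedIdeal_upperCentral (n : ℕ) : IsGradedIdeal K (upperCentral K L n) := by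
  induction n with
  | zero =>
    refine isGradedIdeal_of_left K ?_ ?_
    · intro x hx y
      rw [(Submodule.mem_bot K).1 hx]; simp
    · intro x₀ h₀ x₁ h₁ h
      have h' : x₀ + x₁ = 0 := (Submodule.mem_bot K).1 h
      have e : x₀ = -x₁ := eq_neg_of_add_eq_zero_left h'
      have hx₀ : x₀ = 0 := Submodule.disjoint_def.1 (isCompl (K := K) (L := L)).disjoint x₀ h₀
        (e ▸ neg_mem h₁)
      have hx₁ : x₁ = 0 := by simpa [hx₀] using h'
      subst hx₀; subst hx₁
      exact ⟨zero_mem _, zero_mem _⟩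
  | succ n ih =>
    refine isGradedIdeal_of_left K ?_ ?_
    · intro x hx y z
      exact ih.bracket_left _ (hx y) z
    · intro x₀ h₀ x₁ h₁ h
      have key0 : ∀ y ∈ parity (K := K) (L := L) 0, bracket (K := K) x₀ y ∈ upperCentral K L n ∧
          bracket (K := K) x₁ y ∈ upperCentral K L n := by
        intro y hy
        have := h y
        rw [map_add, LinearMap.add_apply] at this
        exact ih.homogeneous _ (bracket_mem 0 0 _ h₀ _ hy) _ (bracket_mem 1 0 _ h₁ _ hy) this
      have key1 : ∀ y ∈ parity (K := K) (L := L) 1, bracket (K := K) x₁ y ∈ upperCentral K L n ∧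
          bracket (K := K) x₀ y ∈ upperCentral K L n := by
        intro y hy
        have := h y
        rw [map_add, LinearMap.add_apply, add_comm] at this
        exact ih.homogeneous _ (bracket_mem 1 1 _ h₁ _ hy) _ (bracket_mem 0 1 _ h₀ _ hy) this
      constructor
      · intro y
        obtain ⟨y₀, hy₀, y₁, hy₁, rfl⟩ := exists_add K y
        rw [map_add]
        exact add_mem (key0 _ hy₀).1 (key1 _ hy₁).2
      · intro y
        obtain ⟨y₀, hy₀, y₁, hy₁, rfl⟩ := exists_add K y
        rw [map_add]
        exact add_mem (key0 _ hy₀).2 (key1 _ hy₁).1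

variable {K} in
/-- The bracket induced on the quotient by a graded ideal. -/
def quotientBracket {I : Submodule K L} (hI : IsGradedIdeal K I) :
    (L ⧸ I) →ₗ[K] (L ⧸ I) →ₗ[K] (L ⧸ I) :=
  I.liftQ
    { toFun := fun x => I.mapQ I (bracket (K := K) x) (fun y hy => hI.bracket_right x y hy)
      map_add' := fun x y => by
        ext z
        simp only [LinearMap.coe_comp, Function.comp_apply, Submodule.mkQ_apply,
          Submodule.mapQ_apply, map_add, LinearMap.add_apply, Submodule.Quotient.mk_add]
      map_smul' := fun c x => by
        ext z
        simp only [LinearMap.coe_comp, Function.comp_apply, Submodule.mkQ_apply,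
          Submodule.mapQ_apply, map_smul, LinearMap.smul_apply, Submodule.Quotient.mk_smul,
          RingHom.id_apply] }
    (fun x hx => by
      rw [LinearMap.mem_ker]
      ext z
      simp only [LinearMap.coe_mk, AddHom.coe_mk, LinearMap.coe_comp, Function.comp_apply,
        Submodule.mkQ_apply, Submodule.mapQ_apply, LinearMap.zero_apply]
      exact (Submodule.Quotient.mk_eq_zero I).2 (hI.bracket_left x hx z))

variable {K} in
@[simp]
theorem quotientBracket_mk {I : Submodule K L} (hI : IsGradedIdeal K I) (x y : L) :
    quotientBracket hI (I.mkQ x) (I.mkQ y) = I.mkQ (bracket (K := K) x y) := rfl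

variable {K} in
/-- The quotient of a Lie superalgebra by a graded ideal, graded by the images of the even and
the odd part. -/
@[reducible]
def quotient {I : Submodule K L} (hI : IsGradedIdeal K I) : LieSuperalgebra K (L ⧸ I) where
  parity i := (parity (K := K) (L := L) i).map I.mkQ
  isCompl := by
    constructor
    · rw [Submodule.disjoint_def]
      rintro _ ⟨a, ha, rfl⟩ ⟨b, hb, hab⟩
      have hm : a + -b ∈ I := by
        rw [← sub_eq_add_neg]
        exact (Submodule.Quotient.eq I).1 hab.symm
      exact (Submodule.Quotient.mk_eq_zero I).2 (hI.homogeneous a ha (-b) (neg_mem hb) hm).1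
    · rw [codisjoint_iff, ← Submodule.map_sup, (isCompl (K := K) (L := L)).sup_eq_top,
        Submodule.map_top, Submodule.range_mkQ]
  bracket := quotientBracket hI
  bracket_mem := by
    rintro i j _ ⟨x, hx, rfl⟩ _ ⟨y, hy, rfl⟩
    exact ⟨_, bracket_mem i j x hx y hy, rfl⟩
  skew := by
    rintro i j _ ⟨x, hx, rfl⟩ _ ⟨y, hy, rfl⟩
    rw [quotientBracket_mk, quotientBracket_mk, skew i j x hx y hy, map_neg, map_smul]
  jacobi := by
    rintro i j k _ ⟨x, hx, rfl⟩ _ ⟨y, hy, rfl⟩ _ ⟨z, hz, rfl⟩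
    simp only [quotientBracket_mk]
    rw [jacobi i j k x hx y hy z hz, map_add, map_smul]
  even_self := by
    rintro _ ⟨x, hx, rfl⟩
    rw [quotientBracket_mk, even_self x hx, map_zero]
  odd_self := by
    rintro _ ⟨x, hx, rfl⟩
    rw [quotientBracket_mk, quotientBracket_mk, odd_self x hx, map_zero]

/-- The Lie superalgebra `L / Zₙ(L)`. -/
instance quotientUpperCentral (n : ℕ) : LieSuperalgebra K (L ⧸ upperCentral K L n) :=
  quotient (isGradedIdeal_upperCentral K n)

/-- Isomorphisms of Lie superalgebras: even bijective linear maps preserving the bracket. -/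
structure Iso (K : Type u) (L : Type v) (M : Type w) [Field K]
    [AddCommGroup L] [Module K L] [LieSuperalgebra K L]
    [AddCommGroup M] [Module K M] [LieSuperalgebra K M] extends L ≃ₗ[K] M where
  map_parity : ∀ i : ZMod 2, ∀ x ∈ parity (K := K) (L := L) i,
    toLinearEquiv x ∈ parity (K := K) (L := M) i
  map_bracket : ∀ x y : L, toLinearEquiv (bracket (K := K) x y) =
    bracket (K := K) (toLinearEquiv x) (toLinearEquiv y)

/-- `L` is 2-capable if `L ≅ H / Z₂(H)` for some Lie superalgebra `H`, of any dimension. -/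
def IsTwoCapable (K : Type u) (L : Type v) [Field K] [AddCommGroup L] [Module K L]
    [LieSuperalgebra K L] : Prop :=
  ∃ (H : Type (max u v)) (_ : AddCommGroup H) (_ : Module K H) (_ : LieSuperalgebra K H),
    Nonempty (Iso K L (H ⧸ upperCentral K H 2))

/-- The underlying space `Kᵐ ⊕ Kⁿ` of the abelian Lie superalgebra `A(m|n)`. -/
abbrev Abelian (K : Type u) (m n : ℕ) : Type u := (Fin m → K) × (Fin n → K)

/-- `A(m|n)`: even part `Kᵐ`, odd part `Kⁿ`, zero bracket. -/
instance (K : Type u) [Field K] (m n : ℕ) : LieSuperalgebra K (Abelian K m n) where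
  parity i := if i = 0 then LinearMap.range (LinearMap.inl K (Fin m → K) (Fin n → K))
    else LinearMap.range (LinearMap.inr K (Fin m → K) (Fin n → K))
  isCompl := by
    simpa using LinearMap.isCompl_range_inl_inr (R := K) (M := Fin m → K) (M₂ := Fin n → K)
  bracket := 0
  bracket_mem := fun _ _ _ _ _ _ => zero_mem _
  skew := fun _ _ _ _ _ _ => by simp
  jacobi := fun _ _ _ _ _ _ _ _ _ => by simp
  even_self := fun _ _ => rfl
  odd_self := fun _ _ => rfl

end LieSuperalgebra

/-! If `m + n = 1`, suppose `H / Z₂(H)` is spanned by the class of a homogeneous `x`. Then `[x, x]`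
commutes with `x` by the axioms, and with `Z₂(H)` by the Jacobi identity, since `[x, [x, z]] = 0`
for `z ∈ Z₂(H)`. As `H = Kx + Z₂(H)`, the square `[x, x]` is central, so `[x, H] ⊆ Z(H)` and `x ∈
Z₂(H)`: the quotient is zero (`mem_upperCentral_two_of_span`).

If `m + n ≥ 2`, let `H` be spanned by the words of length one to three in `m` even and `n` odd
letters, with longer words set to zero and the supercommutator as bracket. A double bracket of a
combination of words of length at least two vanishes. Conversely, bracketing `x` twice with a letter
`j ≠ i` leaves the coefficient of `i` in `x` at the word `ijj`. Hence `Z₂(H)` is exactly the span of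
the words of length two and three, and the letters span a copy of `A(m|n)` complementary to it. No
step divides by an integer, so the characteristic plays no role. -/

namespace LieSuperalgebra

/-! ### Squares of homogeneous elements and the second centre -/

section UpperCentral

variable {K : Type u} {H : Type v} [Field K] [AddCommGroup H] [Module K H] [LieSuperalgebra K H]

/-- The term `Zₙ₊₁` of the upper central series also brackets into `Zₙ` from the right. -/
theorem bracket_mem_upperCentral_of_right {n : ℕ} {z : H} (hz : z ∈ upperCentral K H (n + 1))
    (x : H) : bracket (K := K) x z ∈ upperCentral K H n := by
  obtain ⟨x₀, hx₀, x₁, hx₁, rfl⟩ := exists_add K x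
  obtain ⟨z₀, hz₀, z₁, hz₁, rfl⟩ := exists_add K z
  obtain ⟨h₀, h₁⟩ := (isGradedIdeal_upperCentral K (n + 1)).homogeneous _ hz₀ _ hz₁ hz
  have key : ∀ i j : ZMod 2, ∀ a ∈ parity (K := K) (L := H) i,
      ∀ b ∈ parity (K := K) (L := H) j, b ∈ upperCentral K H (n + 1) →
      bracket (K := K) a b ∈ upperCentral K H n := by
    intro i j a ha b hb hbZ
    rw [skew i j a ha b hb]
    exact neg_mem (Submodule.smul_mem _ _ (hbZ a))
  simp only [map_add, LinearMap.add_apply]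
  exact add_mem (add_mem (key 0 0 _ hx₀ _ hz₀ h₀) (key 1 0 _ hx₁ _ hz₀ h₀))
    (add_mem (key 0 1 _ hx₀ _ hz₁ h₁) (key 1 1 _ hx₁ _ hz₁ h₁))

/-- A homogeneous element centralizes its own square. -/
theorem bracket_bracket_self_self {i : ZMod 2} {x : H} (hx : x ∈ parity (K := K) i) :
    bracket (K := K) (bracket (K := K) x x) x = 0 := by
  rw [skew (i + i) i _ (bracket_mem i i x hx x hx) x hx]
  fin_cases i
  · rw [even_self x hx]; simp
  · rw [odd_self x hx]; simp

/-- The square of a homogeneous element commutes with the second centre. -/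
theorem bracket_bracket_self_of_mem {i : ZMod 2} {x : H} (hx : x ∈ parity (K := K) i) {z : H}
    (hz : z ∈ upperCentral K H 2) : bracket (K := K) (bracket (K := K) x x) z = 0 := by
  obtain ⟨z₀, hz₀, z₁, hz₁, rfl⟩ := exists_add K z
  obtain ⟨h₀, h₁⟩ := (isGradedIdeal_upperCentral K 2).homogeneous _ hz₀ _ hz₁ hz
  have key : ∀ j : ZMod 2, ∀ b ∈ parity (K := K) (L := H) j, b ∈ upperCentral K H 2 →
      bracket (K := K) (bracket (K := K) x x) b = 0 := by
    intro j b hb hbZ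
    -- Two brackets take `Z₂` to `Z₁` and then to `Z₀ = 0`; this removes both outer terms of the
    -- Jacobi identity for `x, x, b`.
    have h : bracket (K := K) x (bracket (K := K) x b) = 0 :=
      (Submodule.mem_bot K).1
        (bracket_mem_upperCentral_of_right (bracket_mem_upperCentral_of_right hbZ x) x)
    have hj := jacobi i i j x hx x hx b hb
    rw [h, smul_zero, add_zero] at hj
    exact hj.symm
  rw [map_add, key 0 _ hz₀ h₀, key 1 _ hz₁ h₁, add_zero]

/-- `H / Z₂(H)` is never spanned by the class of a homogeneous element outside `Z₂(H)`. -/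
theorem mem_upperCentral_two_of_span {i : ZMod 2} {x : H} (hx : x ∈ parity (K := K) i)
    (hspan : ∀ y : H, ∃ c : K, y - c • x ∈ upperCentral K H 2) : x ∈ upperCentral K H 2 := by
  have hxx : bracket (K := K) x x ∈ upperCentral K H 1 := by
    intro w
    obtain ⟨c, hc⟩ := hspan w
    have hw : w = c • x + (w - c • x) := by abel
    rw [hw, map_add, map_smul, bracket_bracket_self_self hx, bracket_bracket_self_of_mem hx hc,
      smul_zero, add_zero]
    exact zero_mem _
  intro y
  obtain ⟨c, hc⟩ := hspan y
  have hy : y = c • x + (y - c • x) := by abel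
  rw [hy, map_add, map_smul]
  exact add_mem (Submodule.smul_mem _ _ hxx) (bracket_mem_upperCentral_of_right hc x)

end UpperCentral

/-! ### Criteria for and against 2-capability -/

section Capability

variable {K : Type u} {L : Type v} [Field K] [AddCommGroup L] [Module K L] [LieSuperalgebra K L]

/-- A Lie superalgebra spanned by a nonzero homogeneous element is not 2-capable. -/
theorem not_isTwoCapable_of_span {i : ZMod 2} {g : L} (hg : g ∈ parity (K := K) i) (hg0 : g ≠ 0)
    (hspan : ∀ v : L, ∃ c : K, v = c • g) : ¬ IsTwoCapable K L := by
  rintro ⟨H, _, _, _, ⟨e⟩⟩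
  obtain ⟨x, hx, hxg⟩ := e.map_parity i g hg
  have hxZ : x ∈ upperCentral K H 2 := by
    refine mem_upperCentral_two_of_span hx fun y => ?_
    obtain ⟨v, hv⟩ := e.toLinearEquiv.surjective ((upperCentral K H 2).mkQ y)
    obtain ⟨c, rfl⟩ := hspan v
    refine ⟨c, (Submodule.Quotient.eq _).1 ?_⟩
    rw [map_smul, ← hxg, ← map_smul] at hv
    exact hv.symm
  refine hg0 (e.toLinearEquiv.map_eq_zero_iff.1 ?_)
  rw [← hxg]
  exact (Submodule.Quotient.mk_eq_zero _).2 hxZ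

/-- A graded linear complement of `Z₂(H)` that is multiplicative modulo `Z₂(H)` exhibits
2-capability. -/
theorem isTwoCapable_of_section {H : Type max u v} [AddCommGroup H] [Module K H]
    [LieSuperalgebra K H] (s : L →ₗ[K] H)
    (hpar : ∀ i : ZMod 2, ∀ x ∈ parity (K := K) (L := L) i, s x ∈ parity (K := K) i)
    (hbr : ∀ x y : L, s (bracket (K := K) x y) - bracket (K := K) (s x) (s y) ∈
      upperCentral K H 2)
    (hinj : ∀ x : L, s x ∈ upperCentral K H 2 → x = 0)
    (hsurj : ∀ h : H, ∃ x : L, s x - h ∈ upperCentral K H 2) : IsTwoCapable K L := by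
  have hbij : Function.Bijective ((upperCentral K H 2).mkQ ∘ₗ s) := by
    constructor
    · rw [injective_iff_map_eq_zero]
      exact fun x hx => hinj x ((Submodule.Quotient.mk_eq_zero _).1 hx)
    · intro q
      obtain ⟨h, rfl⟩ := Submodule.mkQ_surjective _ q
      obtain ⟨x, hx⟩ := hsurj h
      exact ⟨x, (Submodule.Quotient.eq _).2 hx⟩
  refine ⟨H, inferInstance, inferInstance, inferInstance,
    ⟨{ LinearEquiv.ofBijective _ hbij with map_parity := ?_, map_bracket := ?_ }⟩⟩
  · exact fun i x hx => ⟨s x, hpar i x hx, rfl⟩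
  · exact fun x y => (Submodule.Quotient.eq _).2 (hbr x y)

end Capability

/-! ### Lie superalgebras from associative superalgebras -/

section Supercommutator

variable {K : Type u} {A : Type v} [Field K] [NonUnitalRing A] [Module K A]
  [IsScalarTower K A A] [SMulCommClass K A A]

/-- The supercommutator of an associative superalgebra with odd projection `P`; on homogeneous
elements it is `x * y - (-1) ^ (|x| * |y|) • y * x`. -/
def supercommutator (P : A →ₗ[K] A) : A →ₗ[K] A →ₗ[K] A :=
  LinearMap.mul K A - (LinearMap.mul K A).flip
    + (2 : K) • ((LinearMap.mul K A).flip.compl₁₂ P P)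

theorem supercommutator_apply (P : A →ₗ[K] A) (x y : A) :
    supercommutator P x y = x * y - y * x + (2 : K) • (P y * P x) := rfl

/-- An associative superalgebra, its grading given by the odd projection `P`, is a Lie
superalgebra under the supercommutator. -/
@[reducible]
def ofOddProjection (P : A →ₗ[K] A) (hP : ∀ x, P (P x) = P x)
    -- This says that the product respects the grading: the right side is `x₁y₀ + x₀y₁`.
    (hmul : ∀ x y, P (x * y) = P x * y + x * P y - (2 : K) • (P x * P y)) :
    LieSuperalgebra K A := by
  have h01 : ∀ i : ZMod 2, i = 0 ∨ i = 1 := by decide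
  have hv0 : (0 : ZMod 2).val = 0 := rfl
  have hv1 : (1 : ZMod 2).val = 1 := rfl
  have h11 : (1 : ZMod 2) + 1 = 0 := rfl
  have h1 : ∀ {x : A}, x ∈ LinearMap.range P → P x = x := by
    rintro _ ⟨x, rfl⟩; exact hP x
  have h0 : ∀ {x : A}, x ∈ LinearMap.ker P → P x = 0 := fun h => h
  let par : ZMod 2 → Submodule K A := fun i => if i = 0 then LinearMap.ker P else LinearMap.range P
  -- The parts are eigenspaces of `P` for `0` and `1`, distinct in every field, so degree checks
  -- become scalar identities.
  have hpar : ∀ {i : ZMod 2} {x : A}, x ∈ par i → P x = (i.val : K) • x := by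
    intro i x hx
    obtain rfl | rfl := h01 i
    · simpa [hv0] using h0 hx
    · simpa [hv1] using h1 hx
  have hpar' : ∀ {i : ZMod 2} {x : A}, P x = (i.val : K) • x → x ∈ par i := by
    intro i x hx
    obtain rfl | rfl := h01 i
    · simpa [par, hv0] using hx
    · exact ⟨x, by simpa [hv1] using hx⟩
  have hbr : ∀ (i j : ZMod 2) {x y : A}, x ∈ par i → y ∈ par j →
      supercommutator P x y = x * y - (-1 : K) ^ (i.val * j.val) • (y * x) := by
    intro i j x y hx hy
    rw [supercommutator_apply, hpar hx, hpar hy]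
    obtain rfl | rfl := h01 i <;> obtain rfl | rfl := h01 j <;> simp [hv0, hv1, two_smul]
  have hprod : ∀ (i j : ZMod 2) {x y : A}, x ∈ par i → y ∈ par j → x * y ∈ par (i + j) := by
    intro i j x y hx hy
    apply hpar'
    rw [hmul, hpar hx, hpar hy]
    obtain rfl | rfl := h01 i <;> obtain rfl | rfl := h01 j <;> simp [hv0, hv1, h11, two_smul]
  have hmem : ∀ (i j : ZMod 2) {x y : A}, x ∈ par i → y ∈ par j →
      supercommutator P x y ∈ par (i + j) := by
    intro i j x y hx hy
    rw [hbr i j hx hy]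
    exact sub_mem (hprod i j hx hy)
      (Submodule.smul_mem _ _ (by rw [add_comm]; exact hprod j i hy hx))
  exact
  { parity := par
    isCompl := by
      constructor
      · rw [Submodule.disjoint_def]
        intro x hx hx'
        rw [← h1 hx']; exact h0 hx
      · rw [codisjoint_iff, eq_top_iff]
        intro x _
        refine Submodule.mem_sup.2 ⟨x - P x, ?_, P x, ⟨x, rfl⟩, by abel⟩
        change P (x - P x) = 0
        rw [map_sub, hP, sub_self]
    bracket := supercommutator P
    bracket_mem := fun i j x hx y hy => hmem i j hx hy
    skew := by
      intro i j x hx y hy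
      rw [hbr i j hx hy, hbr j i hy hx]
      obtain rfl | rfl := h01 i <;> obtain rfl | rfl := h01 j <;> simp [hv0, hv1]
    jacobi := by
      intro i j k x hx y hy z hz
      rw [hbr i (j + k) hx (hmem j k hy hz), hbr j k hy hz,
        hbr (i + j) k (hmem i j hx hy) hz, hbr i j hx hy,
        hbr j (i + k) hy (hmem i k hx hz), hbr i k hx hz]
      obtain rfl | rfl := h01 i <;> obtain rfl | rfl := h01 j <;> obtain rfl | rfl := h01 k <;>
        simp [hv0, hv1, h11] <;> noncomm_ring
    even_self := by
      intro x hx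
      rw [hbr 0 0 hx hx]; simp
    odd_self := by
      intro x hx
      rw [hbr 1 (1 + 1) hx (hmem 1 1 hx hx), hbr 1 1 hx hx]
      simp [h11, hv0, hv1]
      noncomm_ring }

end Supercommutator

/-! ### The truncated free associative superalgebra -/

/-- The augmentation ideal of the free associative algebra on `ι`, truncated above degree three:
families of coefficients of the words of length one, two and three. -/
@[ext]
structure TruncatedTensor (K : Type u) (ι : Type v) where
  one : ι → K
  two : ι → ι → K
  three : ι → ι → ι → K

namespace TruncatedTensor

variable {K : Type u} {ι : Type v} [Field K]

instance : Zero (TruncatedTensor K ι) := ⟨⟨0, 0, 0⟩⟩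
instance : Add (TruncatedTensor K ι) :=
  ⟨fun x y => ⟨x.one + y.one, x.two + y.two, x.three + y.three⟩⟩
instance : Neg (TruncatedTensor K ι) := ⟨fun x => ⟨-x.one, -x.two, -x.three⟩⟩
instance : SMul K (TruncatedTensor K ι) := ⟨fun c x => ⟨c • x.one, c • x.two, c • x.three⟩⟩

/-- Concatenation of words, extended bilinearly. -/
instance : Mul (TruncatedTensor K ι) :=
  ⟨fun x y => ⟨0, fun i j => x.one i * y.one j,
    fun i j k => x.one i * y.two j k + x.two i j * y.one k⟩⟩

@[simp] theorem zero_one (i : ι) : (0 : TruncatedTensor K ι).one i = 0 := rfl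
@[simp] theorem zero_two (i j : ι) : (0 : TruncatedTensor K ι).two i j = 0 := rfl
@[simp] theorem zero_three (i j k : ι) : (0 : TruncatedTensor K ι).three i j k = 0 := rfl

section Apply

variable (x y : TruncatedTensor K ι) (c : K) (i j k : ι)

@[simp] theorem add_one : (x + y).one i = x.one i + y.one i := rfl
@[simp] theorem add_two : (x + y).two i j = x.two i j + y.two i j := rfl
@[simp] theorem add_three : (x + y).three i j k = x.three i j k + y.three i j k := rfl
@[simp] theorem neg_one : (-x).one i = -x.one i := rfl
@[simp] theorem neg_two : (-x).two i j = -x.two i j := rfl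
@[simp] theorem neg_three : (-x).three i j k = -x.three i j k := rfl
@[simp] theorem smul_one : (c • x).one i = c * x.one i := rfl
@[simp] theorem smul_two : (c • x).two i j = c * x.two i j := rfl
@[simp] theorem smul_three : (c • x).three i j k = c * x.three i j k := rfl
@[simp] theorem mul_one : (x * y).one i = 0 := rfl
@[simp] theorem mul_two : (x * y).two i j = x.one i * y.one j := rfl
@[simp] theorem mul_three :
    (x * y).three i j k = x.one i * y.two j k + x.two i j * y.one k := rfl

end Apply

instance : NonUnitalRing (TruncatedTensor K ι) where
  add_assoc x y z := by ext <;> simp <;> ring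
  zero_add x := by ext <;> simp
  add_zero x := by ext <;> simp
  add_comm x y := by ext <;> simp <;> ring
  neg_add_cancel x := by ext <;> simp
  nsmul := nsmulRec
  zsmul := zsmulRec
  left_distrib x y z := by ext <;> simp <;> ring
  right_distrib x y z := by ext <;> simp <;> ring
  zero_mul x := by ext <;> simp
  mul_zero x := by ext <;> simp
  mul_assoc x y z := by ext <;> simp; ring

instance : Module K (TruncatedTensor K ι) where
  one_smul x := by ext <;> simp
  mul_smul a b x := by ext <;> simp <;> ring
  smul_zero a := by ext <;> simp
  smul_add a x y := by ext <;> simp <;> ring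
  add_smul a b x := by ext <;> simp <;> ring
  zero_smul x := by ext <;> simp

instance : IsScalarTower K (TruncatedTensor K ι) (TruncatedTensor K ι) :=
  ⟨fun a x y => by ext <;> simp <;> ring⟩

instance : SMulCommClass K (TruncatedTensor K ι) (TruncatedTensor K ι) :=
  ⟨fun a x y => by ext <;> simp <;> ring⟩

@[simp] theorem sub_one (x y : TruncatedTensor K ι) (i : ι) :
    (x - y).one i = x.one i - y.one i := by simp [sub_eq_add_neg]
@[simp] theorem sub_two (x y : TruncatedTensor K ι) (i j : ι) :
    (x - y).two i j = x.two i j - y.two i j := by simp [sub_eq_add_neg]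
@[simp] theorem sub_three (x y : TruncatedTensor K ι) (i j k : ι) :
    (x - y).three i j k = x.three i j k - y.three i j k := by simp [sub_eq_add_neg]

/-- Addition modulo two, on the elements `0` and `1` of a field. -/
def xor (a b : K) : K := a + b - 2 * (a * b)

/-- Projection to the odd part, the letter `i` having degree `q i ∈ {0, 1}`. -/
def oddProjection (q : ι → K) : TruncatedTensor K ι →ₗ[K] TruncatedTensor K ι where
  toFun x := ⟨fun i => q i * x.one i, fun i j => xor (q i) (q j) * x.two i j,
    fun i j k => xor (q i) (xor (q j) (q k)) * x.three i j k⟩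
  map_add' x y := by ext <;> simp <;> ring
  map_smul' c x := by ext <;> simp <;> ring

section OddProjection

variable (q : ι → K) (x : TruncatedTensor K ι) (i j k : ι)

@[simp] theorem oddProjection_one : (oddProjection q x).one i = q i * x.one i := rfl
@[simp] theorem oddProjection_two :
    (oddProjection q x).two i j = xor (q i) (q j) * x.two i j := rfl
@[simp] theorem oddProjection_three :
    (oddProjection q x).three i j k = xor (q i) (xor (q j) (q k)) * x.three i j k := rfl

end OddProjection

theorem xor_mul_self {a b : K} (ha : a * a = a) (hb : b * b = b) :
    xor a b * xor a b = xor a b := by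
  unfold xor
  linear_combination (1 - 4 * b + 4 * b ^ 2) * ha + hb

theorem oddProjection_oddProjection {q : ι → K} (hq : ∀ i, q i * q i = q i)
    (x : TruncatedTensor K ι) : oddProjection q (oddProjection q x) = oddProjection q x := by
  ext i j k
  · simp [← mul_assoc, hq]
  · simp [← mul_assoc, xor_mul_self (hq _) (hq _)]
  · simp [← mul_assoc, xor_mul_self (hq _) (xor_mul_self (hq _) (hq _))]

/-- With degrees taken in `K` and `xor` a polynomial, this is a polynomial identity in each
coefficient, valid for arbitrary `q`. -/
theorem oddProjection_mul (q : ι → K) (x y : TruncatedTensor K ι) :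
    oddProjection q (x * y) = oddProjection q x * y + x * oddProjection q y
      - (2 : K) • (oddProjection q x * oddProjection q y) := by
  ext i j k <;> simp [xor] <;> ring

/-- A letter, as an element of degree one. -/
def letter [DecidableEq ι] (j : ι) : TruncatedTensor K ι := ⟨Pi.single j 1, 0, 0⟩

/-! ### The second centre of the truncated algebra -/

section SecondCentre

variable {q : ι → K} [LieSuperalgebra K (TruncatedTensor K ι)]
  (hbr : bracket (K := K) (L := TruncatedTensor K ι) = supercommutator (oddProjection q))

include hbr

/-- Each bracket raises word length by at least one, so two brackets reach length four, where
everything is zero. -/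
theorem mem_upperCentral_two_of_one_eq_zero {x : TruncatedTensor K ι} (hx : ∀ i, x.one i = 0) :
    x ∈ upperCentral K (TruncatedTensor K ι) 2 := by
  intro y z
  refine (Submodule.mem_bot K).2 ?_
  ext <;> simp [hbr, supercommutator_apply, hx]

theorem one_eq_zero_of_mem_upperCentral_two [Nontrivial ι] {x : TruncatedTensor K ι}
    (hx : x ∈ upperCentral K (TruncatedTensor K ι) 2) (i : ι) : x.one i = 0 := by
  classical
  obtain ⟨j, hj⟩ := exists_ne i
  -- Among the terms of `[[x, j], j]`, only `x * j * j` contributes to the word `ijj`: in all the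
  -- others a letter `j ≠ i` comes first.
  have h := congrArg (fun t => t.three i j j)
    ((Submodule.mem_bot K).1 (hx (letter j) (letter j)))
  simpa [hbr, supercommutator_apply, letter, hj.symm] using h

end SecondCentre

end TruncatedTensor

/-! ### The abelian Lie superalgebras -/

open TruncatedTensor in
theorem isTwoCapable_abelian (K : Type u) [Field K] {m n : ℕ} (h : 2 ≤ m + n) :
    IsTwoCapable K (Abelian K m n) := by
  let q : Fin m ⊕ Fin n → K := Sum.elim 0 1
  have hq : ∀ i, q i * q i = q i := by rintro (i | i) <;> simp [q]
  let _ : LieSuperalgebra K (TruncatedTensor K (Fin m ⊕ Fin n)) :=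
    ofOddProjection (oddProjection q) (oddProjection_oddProjection hq) (oddProjection_mul q)
  have hbr : bracket (K := K) (L := TruncatedTensor K (Fin m ⊕ Fin n)) =
    supercommutator (oddProjection q) := rfl
  have : Nontrivial (Fin m ⊕ Fin n) := by
    rw [← Fintype.one_lt_card_iff_nontrivial]
    rw [Fintype.card_sum, Fintype.card_fin, Fintype.card_fin]
    omega
  -- The image is the span of the letters; their brackets have length two, hence lie in `Z₂`.
  let s : Abelian K m n →ₗ[K] TruncatedTensor K (Fin m ⊕ Fin n) :=
    { toFun := fun v => ⟨Sum.elim v.1 v.2, 0, 0⟩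
      map_add' := fun v w => by ext (i | i) <;> simp
      map_smul' := fun c v => by ext (i | i) <;> simp }
  refine isTwoCapable_of_section s ?_ ?_ ?_ ?_
  · intro i x hx
    fin_cases i
    · obtain ⟨a, rfl⟩ := hx
      change oddProjection q _ = 0
      ext (i | i) <;> simp [s, q]
    · obtain ⟨a, rfl⟩ := hx
      refine ⟨s (0, a), ?_⟩
      ext (i | i) <;> simp [s, q]
  · intro x y
    apply mem_upperCentral_two_of_one_eq_zero hbr
    have h0 : bracket (K := K) x y = 0 := rfl
    simp [h0, hbr, supercommutator_apply]
  · intro x hx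
    have h0 := one_eq_zero_of_mem_upperCentral_two hbr hx
    ext i
    · exact h0 (Sum.inl i)
    · exact h0 (Sum.inr i)
  · intro t
    refine ⟨(fun i => t.one (Sum.inl i), fun i => t.one (Sum.inr i)), ?_⟩
    apply mem_upperCentral_two_of_one_eq_zero hbr
    rintro (i | i) <;> simp [s]

theorem not_isTwoCapable_abelian (K : Type u) [Field K] {m n : ℕ} (h : m + n = 1) :
    ¬ IsTwoCapable K (Abelian K m n) := by
  obtain ⟨rfl, rfl⟩ | ⟨rfl, rfl⟩ : m = 1 ∧ n = 0 ∨ m = 0 ∧ n = 1 := by omega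
  · refine not_isTwoCapable_of_span (i := 0) (g := ((1, 0) : Abelian K 1 0)) ⟨1, rfl⟩ ?_ ?_
    · simp
    · intro v
      refine ⟨v.1 0, ?_⟩
      ext i
      · simp [Subsingleton.elim i 0]
      · exact i.elim0
  · refine not_isTwoCapable_of_span (i := 1) (g := ((0, 1) : Abelian K 0 1)) ⟨1, rfl⟩ ?_ ?_
    · simp
    · intro v
      refine ⟨v.2 0, ?_⟩
      ext i
      · exact i.elim0
      · simp [Subsingleton.elim i 0]

end LieSuperalgebra

theorem mainTheorem12 (K : Type u) [Field K] (m n : ℕ) (hmn : m + n ≠ 0) :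
    LieSuperalgebra.IsTwoCapable K (LieSuperalgebra.Abelian K m n) ↔ 2 ≤ m + n := by
  refine ⟨fun h => ?_, LieSuperalgebra.isTwoCapable_abelian K⟩
  by_contra h2
  exact LieSuperalgebra.not_isTwoCapable_abelian K (by omega) h
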